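/- All structures are multisorted relational structures: a signature consists of a set of types and a set of relational symbols, the arity $\mathrm{ar}_R$ of a symbol $R$ being a finite tuple of types; a structure $\mathbf A$ has a set $A_t$ for each type $t$ and a relation $R^{\mathbf A}\subseteq\prod_i A_{\mathrm{ar}_R(i)}$ for each symbol $R$; elements of different types are considered different. Homomorphisms preserve types and relations, and $\mathbf X\to\mathbf A$ means that a homomorphism exists. Fix a finite signature $\Pi$ and an integer $k\ge 1$, and let $\mathbf A,\mathbf A'$ be $\Pi$-structures with $\mathbf A$ finite and $\mathbf A\to\mathbf A'$. An instance $\mathbf X$ of $\mathrm{PCSP}(\mathbf A,\mathbf A')$ is a finite $\Pi$-structure; it is positive if $\mathbf X\to\mathbf A$ and negative if $\mathbf X\not\to\mathbf A'$. *$k$-consistency.* For each set $K$ of at most $k$ elements of $\mathbf X$, let $\mathcal F_K$ initially be the set of all partial homomorphisms from $K$ to $\mathbf A$ (type-preserving maps $f\colon K\to A$ that preserve every relation on the tuples with all entries in $K$). As long as anything changes, for all $L\subseteq K$ with $|K|\le k$, remove from $\mathcal F_L$ all maps that do not extend to a member of $\mathcal F_K$, and remove from $\mathcal F_K$ all maps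 whose restriction to $L$ is not in $\mathcal F_L$. The *$k$-consistency test* accepts $\mathbf X$ if all the resulting sets $\mathcal F_K$ are non-empty, and rejects it otherwise. $\mathrm{PCSP}(\mathbf A,\mathbf A')$ *has width (at most) $k$* if the test accepts all positive instances and rejects all negative instances. *$k$-consistency reduction.* For a structure $\mathbf B$ (possibly of another signature), the $k$-consistency reduction maps $\mathbf X$ to the structure $\kappa_k^{\mathbf A,\mathbf B}(\mathbf X)$ obtained from the disjoint union, over all sets $K$ of at most $k$ elements of $\mathbf X$, of copies of the powers $\mathbf B^{\mathcal F_K}$ (with elements $(K;b)$, where $b\colon\mathcal F_K\to B_t$ and $\mathcal F_K$ are the resulting sets above) by identifying $(K;b\circ\rho)$ with $(L;b)$ for all $L\subseteq K$ and $b\colon\mathcal F_L\to B_t$, where $\rho\colon\mathcal F_K\to\mathcal F_L$ is the restriction. $\mathrm{PCSP}(\mathbf A,\mathbf A')$ reduces to $\mathrm{CSP}(\mathbf B)$ by the $k$-consistency reduction if, for every instance $\mathbf X$, $\mathbf X\to\mathbf A$ implies $\kappa_k^{\mathbf A,\mathbf B}(\mathbf X)\to\mathbf B$, and $\mathbf X\not\to\mathbf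 A'$ implies $\kappa_k^{\mathbf A,\mathbf B}(\mathbf X)\not\to\mathbf B$. *Trivial CSP.* Let $\bot$ be the structure with empty relation over the signature that has no types and a single nullary symbol. The trivial CSP is $\mathrm{CSP}(\bot)$. *Datalog.* A Datalog program consists of finitely many additional relational symbols, finitely many rules $t_0\leftarrow t_1,\dots,t_r$ with $t_i$ atomic formulae in typed variables over the extended signature (equalities are allowed in the body only, and the symbol in the head $t_0$ is one of the additional symbols), and an output symbol; it is evaluated on a structure by the usual least fixed point semantics. Its width is at most $k$ if every rule contains at most $k$ variables. It is a Datalog sentence if the output symbol is nullary. **Theorem.** The following are equivalent: 1. $\mathrm{PCSP}(\mathbf A,\mathbf A')$ has width $k$, i.e. it is solved by the $k$-consistency test; 2. there is a Datalog sentence of width at most $k$ that is true in all negative instances and false in all positive instances of $\mathrm{PCSP}(\mathbf A,\mathbf A')$; 3. $\mathrm{PCSP}(\mathbf A,\mathbf A')$ reduces to $\mathrm{CSP}(\bot)$ by the $k$-consistency reduction. -/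

import Mathlib

namespace PCSP

universe u v w w'

/-- A multisorted relational signature: types, relational symbols, and for each symbol its arity,
which is a tuple (list) of types. -/
structure Signature where
  Ty : Type u
  Sym : Type v
  ar : Sym → List Ty

/-- A relational structure: a set for each type, a relation of the right arity for each symbol. -/
structure Str (S : Signature.{u, v}) where
  dom : S.Ty → Type w
  rel : (R : S.Sym) → Set ((i : Fin (S.ar R).length) → dom ((S.ar R).get i))

/-- A signature is finite if it has finitely many types and finitely many symbols. -/
def Signature.IsFinite (S : Signature.{u, v}) : Prop :=
  Finite S.Ty ∧ Finite S.Sym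

/-- A structure is finite if all its domains are. -/
def Str.IsFinite {S : Signature.{u, v}} (A : Str.{u, v, w} S) : Prop :=
  ∀ t, Finite (A.dom t)

/-- `A.MapsTo B` says that there is a homomorphism from `A` to `B`. -/
def Str.MapsTo {S : Signature.{u, v}} (A : Str.{u, v, w} S) (B : Str.{u, v, w'} S) : Prop :=
  ∃ f : (t : S.Ty) → A.dom t → B.dom t,
    ∀ (R : S.Sym) (a : (i : Fin (S.ar R).length) → A.dom ((S.ar R).get i)),
      a ∈ A.rel R → (fun i => f _ (a i)) ∈ B.rel R

/-- The elements of a structure; elements of different types are different. -/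
abbrev Str.Elem {S : Signature.{u, v}} (A : Str.{u, v, w} S) : Type (max u w) :=
  Σ t : S.Ty, A.dom t

/-- The power of a structure with exponent `I`. -/
def Str.pow {S : Signature.{u, v}} (B : Str.{u, v, w} S) (I : Type w') :
    Str.{u, v, max w w'} S where
  dom t := I → B.dom t
  rel R := {b | ∀ j : I, (fun i => b i j) ∈ B.rel R}

/-- `ψ` is a reduction from the promise CSP with template `(A, A')` to the one with template
`(B, B')`. The inputs are the finite structures. -/
def IsReduction {P : Signature.{u, v}} {S : Signature} (A A' : Str.{u, v, w} P)
    (B B' : Str S) (ψ : Str.{u, v, w} P → Str S) : Prop :=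
  (∀ X : Str.{u, v, w} P, X.IsFinite → X.MapsTo A → (ψ X).MapsTo B) ∧
  (∀ X : Str.{u, v, w} P, X.IsFinite → ¬ X.MapsTo A' → ¬ (ψ X).MapsTo B')

/-- The decision procedure with the set `acc` of accepted structures solves the promise CSP with
template `(A, A')`. -/
def Solves {P : Signature.{u, v}} (acc : Str.{u, v, w} P → Prop) (A A' : Str.{u, v, w} P) :
    Prop :=
  (∀ X : Str.{u, v, w} P, X.IsFinite → X.MapsTo A → acc X) ∧
  (∀ X : Str.{u, v, w} P, X.IsFinite → ¬ X.MapsTo A' → ¬ acc X)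

/-! ### The trivial CSP -/

/-- The signature without types and with a single nullary symbol. -/
def trivialSig : Signature.{0, 0} where
  Ty := Empty
  Sym := Unit
  ar _ := []

/-- The structure over the trivial signature whose nullary relation is empty. -/
def botStr : Str.{0, 0, 0} trivialSig where
  dom t := nomatch t
  rel _ := ∅

/-! ### Enforcing consistency -/

section Consistency

variable {P : Signature.{u, v}}

/-- Type-preserving maps from a finite set `K` of elements of `X` to `A`. -/
abbrev PMap (X A : Str.{u, v, w} P) (K : Finset X.Elem) : Type (max u w) :=
  (x : {x : X.Elem // x ∈ K}) → A.dom x.1.1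

/-- Restriction of a map defined on `K` to a subset `L`. -/
def PMap.restrict {X A : Str.{u, v, w} P} {K L : Finset X.Elem} (h : L ⊆ K) (g : PMap X A K) :
    PMap X A L :=
  fun x => g ⟨x.1, h x.2⟩

/-- `f` is a partial homomorphism from `K` to `A`. -/
def PMap.IsPartialHom {X A : Str.{u, v, w} P} {K : Finset X.Elem} (f : PMap X A K) : Prop :=
  ∀ (R : P.Sym) (a : (i : Fin (P.ar R).length) → X.dom ((P.ar R).get i))
    (ha : ∀ i, (⟨(P.ar R).get i, a i⟩ : X.Elem) ∈ K),
    a ∈ X.rel R → (fun i => f ⟨⟨(P.ar R).get i, a i⟩, ha i⟩) ∈ A.rel R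

/-- The sets of maps after `n` rounds of enforcing consistency between the sets of at most `k`
elements: at first all partial homomorphisms, and then each round removes the maps that have a
restriction which is not in the respective set, or fail to extend to some set of size at most
`k`. -/
def rounds (k : ℕ) (A X : Str.{u, v, w} P) : ℕ → (K : Finset X.Elem) → Set (PMap X A K)
  | 0, _ => {f | f.IsPartialHom}
  | n + 1, K => {f | f ∈ rounds k A X n K ∧
      (∀ (L : Finset X.Elem) (h : L ⊆ K), f.restrict h ∈ rounds k A X n L) ∧
      (∀ (M : Finset X.Elem) (h : K ⊆ M), M.card ≤ k →
        ∃ g ∈ rounds k A X n M, g.restrict h = f)}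

/-- The sets output by the `k`-consistency algorithm: the maps that are never removed. (For finite
`X` and `A`, the decreasing sequence of rounds stabilises and this is its final value.) -/
def consistent (k : ℕ) (A X : Str.{u, v, w} P) (K : Finset X.Elem) : Set (PMap X A K) :=
  {f | ∀ n, f ∈ rounds k A X n K}

theorem restrict_mem_consistent {k : ℕ} {A X : Str.{u, v, w} P} {K L : Finset X.Elem}
    (h : L ⊆ K) {g : PMap X A K} (hg : g ∈ consistent k A X K) :
    g.restrict h ∈ consistent k A X L :=
  fun n => (hg (n + 1)).2.1 L h

/-- The `k`-consistency test accepts `X` if all the sets output by the `k`-consistency algorithm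
are non-empty. -/
def TestAccepts (k : ℕ) (A X : Str.{u, v, w} P) : Prop :=
  ∀ K : Finset X.Elem, K.card ≤ k → (consistent k A X K).Nonempty

/-- The promise CSP with template `(A, A')` has width (at most) `k`: it is solved by the
`k`-consistency test. -/
def HasWidth (k : ℕ) (A A' : Str.{u, v, w} P) : Prop :=
  Solves (TestAccepts k A) A A'

/-! ### The consistency reduction -/

/-- The sets of at most `k` elements of `X`. -/
abbrev SmallSet (k : ℕ) (X : Str.{u, v, w} P) : Type (max u w) :=
  {K : Finset X.Elem // K.card ≤ k}

/-- The elements `(K; b)` of type `t` of the disjoint union, over all sets `K` of at most `k`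
elements, of copies of the powers of `B` with exponent `consistent k A X K`. -/
abbrev PreElem {S : Signature} (k : ℕ) (A X : Str.{u, v, w} P) (B : Str S) (t : S.Ty) : Type _ :=
  Σ K : SmallSet k X, (B.pow (consistent k A X K.1)).dom t

/-- The pairs `(K; b ∘ ρ)`, `(L; b)` that are identified, where `L ⊆ K` and `ρ` is the
restriction from `K` to `L`. -/
inductive Glue {S : Signature} (k : ℕ) (A X : Str.{u, v, w} P) (B : Str S) (t : S.Ty) :
    PreElem k A X B t → PreElem k A X B t → Prop
  | mk (K L : SmallSet k X) (h : L.1 ⊆ K.1) (b : consistent k A X L.1 → B.dom t) :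
      Glue k A X B t
        ⟨K, fun g => b ⟨g.1.restrict h, restrict_mem_consistent h g.2⟩⟩ ⟨L, b⟩

/-- The output of the `k`-consistency reduction (with the templates `A` and `B`) on the
structure `X`. `Quot` is the quotient by the equivalence relation generated by `Glue`. -/
def kappa {S : Signature} (k : ℕ) (A : Str.{u, v, w} P) (B : Str S) (X : Str.{u, v, w} P) :
    Str S where
  dom t := Quot (Glue k A X B t)
  rel R := {y | ∃ (K : SmallSet k X), ∃ b ∈ (B.pow (consistent k A X K.1)).rel R,
    y = fun i => Quot.mk _ ⟨K, b i⟩}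

/-- The promise CSP with template `(A, A')` reduces to the one with template `(B, B')` by the
`k`-consistency reduction. -/
def ReducesByConsistency {S : Signature} (k : ℕ) (A A' : Str.{u, v, w} P) (B B' : Str S) :
    Prop :=
  IsReduction A A' B B' (kappa k A B)

end Consistency

/-! ### Datalog -/

/-- The signature with the types of `S` and with additional symbols `I` of arities `arI`. -/
def Signature.extend (S : Signature.{u, v}) (I : Type) (arI : I → List S.Ty) :
    Signature.{u, v} where
  Ty := S.Ty
  Sym := S.Sym ⊕ I
  ar := Sum.elim S.ar arI

/-- Atomic formulae of signature `S` in typed variables: `V t` is the set of variables of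
type `t`. -/
inductive Atom (S : Signature.{u, v}) (V : S.Ty → Type) : Type (max u v)
  | rel (R : S.Sym) (x : (i : Fin (S.ar R).length) → V ((S.ar R).get i)) : Atom S V
  | eq (t : S.Ty) (x y : V t) : Atom S V

/-- A variable occurs in an atomic formula. -/
def Atom.Occurs {S : Signature.{u, v}} {V : S.Ty → Type} (x : Σ t, V t) : Atom S V → Prop
  | .rel R y => ∃ i, (⟨(S.ar R).get i, y i⟩ : Σ t, V t) = x
  | .eq t y z => (⟨t, y⟩ : Σ t, V t) = x ∨ (⟨t, z⟩ : Σ t, V t) = x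

/-- An atomic formula holds in a structure after the substitution `h`. -/
def Atom.Holds {S : Signature.{u, v}} {V : S.Ty → Type} (B : Str.{u, v, w} S)
    (h : (t : S.Ty) → V t → B.dom t) : Atom S V → Prop
  | .rel R y => (fun i => h _ (y i)) ∈ B.rel R
  | .eq t y z => h t y = h t z

/-- A Datalog rule with input signature `S` and additional symbols `I`. The head is an atomic
formula with a symbol from `I`, the body is a list of atomic formulae in the extended signature.
The variables of type `t` are numbered by `Fin (nvar t)`, and they all occur in the rule. -/
structure Rule (S : Signature.{u, v}) (I : Type) (arI : I → List S.Ty) where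
  nvar : S.Ty → ℕ
  head : I
  headArgs : (i : Fin (arI head).length) → Fin (nvar ((arI head).get i))
  body : List (Atom (S.extend I arI) (fun t => Fin (nvar t)))
  occurs : ∀ x : (Σ t : S.Ty, Fin (nvar t)),
    (∃ i, (⟨(arI head).get i, headArgs i⟩ : Σ t : S.Ty, Fin (nvar t)) = x) ∨
      ∃ a ∈ body, Atom.Occurs (S := S.extend I arI) x a

/-- The number of variables of a rule. -/
noncomputable def Rule.numVars {S : Signature.{u, v}} {I : Type} {arI : I → List S.Ty}
    (r : Rule S I arI) : ℕ∞ :=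
  ENat.card (Σ t : S.Ty, Fin (r.nvar t))

/-- A Datalog program with input signature `S`: finitely many additional (intensional) symbols,
finitely many rules, and an output symbol of the extended signature. -/
structure Program (S : Signature.{u, v}) where
  I : Type
  finite_I : Finite I
  arI : I → List S.Ty
  rules : Set (Rule S I arI)
  finite_rules : rules.Finite
  output : (S.extend I arI).Sym

namespace Program

variable {S : Signature.{u, v}}

/-- All rules have at most `k` variables. -/
def WidthAtMost (φ : Program S) (k : ℕ) : Prop :=
  ∀ r ∈ φ.rules, r.numVars ≤ k

/-- The output symbol is nullary. -/
def IsSentence (φ : Program S) : Prop :=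
  (S.extend φ.I φ.arI).ar φ.output = []

/-- The structure over the extended signature given by `X` and by an interpretation of the
intensional symbols. -/
def expand (φ : Program S) (X : Str.{u, v, w} S)
    (J : (Q : φ.I) → Set ((i : Fin (φ.arI Q).length) → X.dom ((φ.arI Q).get i))) :
    Str.{u, v, w} (S.extend φ.I φ.arI) where
  dom := X.dom
  rel
    | .inl R => X.rel R
    | .inr Q => J Q

/-- The intensional relations after `n` rounds of the evaluation on `X`: start with empty
relations; in each round, include the heads of all rules under all assignments which satisfy
the body. -/
def stage (φ : Program S) (X : Str.{u, v, w} S) :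
    ℕ → (Q : φ.I) → Set ((i : Fin (φ.arI Q).length) → X.dom ((φ.arI Q).get i))
  | 0, _ => ∅
  | n + 1, Q => stage φ X n Q ∪
      {y | ∃ r ∈ φ.rules, ∃ h : (t : S.Ty) → Fin (r.nvar t) → X.dom t,
        (∀ a ∈ r.body, a.Holds (φ.expand X (stage φ X n)) h) ∧
        (⟨r.head, fun i => h _ (r.headArgs i)⟩ :
          Σ Q : φ.I, ((i : Fin (φ.arI Q).length) → X.dom ((φ.arI Q).get i))) = ⟨Q, y⟩}

/-- The fixed point of the evaluation on `X`. -/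
def eval (φ : Program S) (X : Str.{u, v, w} S) : Str.{u, v, w} (S.extend φ.I φ.arI) :=
  φ.expand X (fun Q => {y | ∃ n, y ∈ φ.stage X n Q})

/-- A Datalog sentence is true in `X` if its (nullary) output relation is non-empty. -/
def IsTrue (φ : Program S) (X : Str.{u, v, w} S) : Prop :=
  ((φ.eval X).rel φ.output).Nonempty

end Program

/-- The promise CSP with template `(A, A')` is expressible by a Datalog sentence of width at most
`k`, which is true in all negative instances and false in all positive ones. -/
def DatalogExpressible {P : Signature.{u, v}} (k : ℕ) (A A' : Str.{u, v, w} P) : Prop :=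
  ∃ φ : Program P, φ.IsSentence ∧ φ.WidthAtMost k ∧ Solves (fun X => ¬ φ.IsTrue X) A A'

end PCSP

/-!
The sets output by the `k`-consistency algorithm form the largest family of partial homomorphisms
`X ⇀ A` which is closed under restriction and under extension to sets of at most `k` elements.
Since a relation of a power over the empty exponent is full, `κ_k(X)` maps to `⊥` if and only if no
member of this family is empty.

A rule with at most `k` variables only looks at `k` elements of `X` at a time, so a member of such a
family maps the facts which a program of width `k` derives in `X` into every model of the program
over `A`. Hence a sentence which is true in `X` and false in `A` witnesses that the test rejects
`X`.

Conversely, name all relations of arity at most `k` on `A` by additional symbols, and consider the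
*canonical program* of all rules with at most `k` variables that are valid in `A`; its output names
the empty nullary relation. The partial homomorphisms that preserve all derived facts can be
extended: the images of a listing of `L` under the maps on `K ⊇ L` form a relation on `A`, and the
rule stating that this relation contains the listing, whose body is the diagram of `K`, is valid.
Therefore the listing is derived to lie in this relation, and a map on `L` that preserves this fact
is a restriction of a map on `K`.
-/

namespace PCSP

universe u v w

section Tuples

variable {S : Signature.{u, v}}

/-- The tuples of elements of `X` whose types are listed in `τ`. -/
abbrev Str.Tuple (X : Str.{u, v, w} S) (τ : List S.Ty) : Type w :=
  (i : Fin τ.length) → X.dom (τ.get i)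

/-- The `i`-th entry of a tuple, as an element of the disjoint union of all domains. -/
abbrev Str.entry (X : Str.{u, v, w} S) {τ : List S.Ty} (y : X.Tuple τ) (i : Fin τ.length) :
    X.Elem :=
  ⟨τ.get i, y i⟩

theorem Str.exists_tuple_range_eq (X : Str.{u, v, w} S) (L : Finset X.Elem) :
    ∃ (τ : List S.Ty) (y : X.Tuple τ), τ.length = L.card ∧
      Set.range (X.entry y) = (L : Set X.Elem) := by
  classical
  induction L using Finset.induction_on with
  | empty => exact ⟨[], fun i => i.elim0, rfl, by simp⟩
  | insert a L ha ih =>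
    obtain ⟨τ, y, hlen, hy⟩ := ih
    let z : X.Tuple (a.1 :: τ) := Fin.cons a.2 y
    have hz : X.entry z = Fin.cons a (X.entry y) := funext fun i => by
      cases i using Fin.cases <;> rfl
    refine ⟨a.1 :: τ, z, by rw [List.length_cons, hlen, Finset.card_insert_of_notMem ha], ?_⟩
    rw [hz, Finset.coe_insert, ← hy]
    exact Fin.range_cons a (X.entry y)

variable {X A : Str.{u, v, w} S} {K L : Finset X.Elem}

/-- The image under `f` of a tuple with entries in `K`. -/
def PMap.mapTuple (f : PMap X A K) {τ : List S.Ty} (y : X.Tuple τ)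
    (hy : ∀ i, X.entry y i ∈ K) : A.Tuple τ :=
  fun i => f ⟨X.entry y i, hy i⟩

/-- The map `f` sends the tuples of `ρ` with entries in `K` to tuples of `σ`. -/
def PMap.Preserves (f : PMap X A K) {τ : List S.Ty} (ρ : Set (X.Tuple τ))
    (σ : Set (A.Tuple τ)) : Prop :=
  ∀ (y : X.Tuple τ) (hy : ∀ i, X.entry y i ∈ K), y ∈ ρ → f.mapTuple y hy ∈ σ

end Tuples

section Consistency

variable {P : Signature.{u, v}} {k : ℕ} {A X : Str.{u, v, w} P} {K L M : Finset X.Elem}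

theorem rounds_antitone (k : ℕ) (A : Str.{u, v, w} P) (K : Finset X.Elem) :
    Antitone fun n => rounds k A X n K :=
  antitone_nat_of_succ_le fun _ _ hf => hf.1

/-- A family of partial homomorphisms which is closed under restriction and in which every map
extends to every set of at most `k` elements. As in the definition of `consistent`, the sizes of the
domains of the maps are not bounded by `k`. -/
structure IsConsistentFamily (k : ℕ) (G : (K : Finset X.Elem) → Set (PMap X A K)) : Prop where
  isPartialHom {K : Finset X.Elem} {f : PMap X A K} : f ∈ G K → f.IsPartialHom
  restrict_mem {K L : Finset X.Elem} (h : L ⊆ K) {f : PMap X A K} : f ∈ G K → f.restrict h ∈ G L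
  exists_extension {L K : Finset X.Elem} (h : L ⊆ K) (hK : K.card ≤ k) {f : PMap X A L} :
    f ∈ G L → ∃ g ∈ G K, g.restrict h = f

/-- The extensions available in each round may depend on the round; since there are finitely many
maps, one of them is available in infinitely many rounds. -/
theorem exists_extension_mem_consistent (hA : A.IsFinite) (h : L ⊆ K) (hK : K.card ≤ k)
    {f : PMap X A L} (hf : f ∈ consistent k A X L) :
    ∃ g ∈ consistent k A X K, g.restrict h = f := by
  have : ∀ t, Finite (A.dom t) := hA
  choose g hg hgf using fun n => (hf (n + 1)).2.2 K h hK
  obtain ⟨g₀, hg₀⟩ := Finite.exists_infinite_fiber g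
  rw [Set.infinite_coe_iff] at hg₀
  refine ⟨g₀, fun n => ?_, ?_⟩
  · obtain ⟨m, rfl, hnm⟩ := hg₀.exists_gt n
    exact rounds_antitone k A K hnm.le (hg m)
  · obtain ⟨m, rfl⟩ := hg₀.nonempty
    exact hgf m

theorem isConsistentFamily_consistent (hA : A.IsFinite) :
    IsConsistentFamily k (consistent k A X) where
  isPartialHom hf := hf 0
  restrict_mem := restrict_mem_consistent
  exists_extension h hK _ hf := exists_extension_mem_consistent hA h hK hf

namespace IsConsistentFamily

variable {G : (K : Finset X.Elem) → Set (PMap X A K)}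

theorem subset_consistent (hG : IsConsistentFamily k G) (K : Finset X.Elem) :
    G K ⊆ consistent k A X K := by
  intro f hf n
  induction n generalizing K with
  | zero => exact hG.isPartialHom hf
  | succ n ih =>
    refine ⟨ih K hf, fun L h => ih L (hG.restrict_mem h hf), fun M h hM => ?_⟩
    obtain ⟨g, hg, hgf⟩ := hG.exists_extension h hM hf
    exact ⟨g, ih M hg, hgf⟩

theorem testAccepts (hG : IsConsistentFamily k G) (hne : (G ∅).Nonempty) : TestAccepts k A X := by
  intro K hK
  obtain ⟨f, hf⟩ := hne
  obtain ⟨g, hg, -⟩ := hG.exists_extension K.empty_subset hK hf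
  exact ⟨g, hG.subset_consistent K hg⟩

theorem exists_mem_eqOn_inter (hG : IsConsistentFamily k G) {f : PMap X A K} (hf : f ∈ G K)
    (hM : M.card ≤ k) :
    ∃ g ∈ G M, ∀ x (hxK : x ∈ K) (hxM : x ∈ M), g ⟨x, hxM⟩ = f ⟨x, hxK⟩ := by
  classical
  obtain ⟨g, hg, hgf⟩ := hG.exists_extension (Finset.inter_subset_right (s₁ := K)) hM
    (hG.restrict_mem Finset.inter_subset_left hf)
  exact ⟨g, hg, fun x hxK hxM => congrFun hgf ⟨x, Finset.mem_inter.2 ⟨hxK, hxM⟩⟩⟩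

end IsConsistentFamily

theorem Str.MapsTo.testAccepts (h : X.MapsTo A) : TestAccepts k A X := by
  obtain ⟨f, hf⟩ := h
  let restriction (K : Finset X.Elem) : PMap X A K := fun x => f _ x.1.2
  have hG : IsConsistentFamily k fun K => {restriction K} :=
    { isPartialHom := by
        rintro K _ rfl R a - haR
        exact hf R a haR
      restrict_mem := by
        rintro K L h _ rfl
        rfl
      exists_extension := by
        rintro L K h - _ rfl
        exact ⟨_, rfl, rfl⟩ }
  exact hG.testAccepts (Set.singleton_nonempty _)

theorem kappa_botStr_mapsTo_iff :
    (kappa k A botStr X).MapsTo botStr ↔ TestAccepts k A X := by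
  constructor
  · rintro ⟨_, hf⟩ K hK
    by_contra hempty
    exact hf () _ ⟨⟨K, hK⟩, fun i => i.elim0, fun j => hempty ⟨j.1, j.2⟩, rfl⟩
  · intro h
    refine ⟨fun t => t.elim, ?_⟩
    rintro R a ⟨K, b, hb, -⟩
    obtain ⟨j, hj⟩ := h K.1 K.2
    exact hb ⟨j, hj⟩

theorem reducesByConsistency_botStr_iff {A' : Str.{u, v, w} P} :
    ReducesByConsistency k A A' botStr botStr ↔ HasWidth k A A' := by
  simp only [ReducesByConsistency, IsReduction, HasWidth, Solves, kappa_botStr_mapsTo_iff]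

end Consistency

section Expansions

variable {S : Signature.{u, v}} {I : Type} {arI : I → List S.Ty}

/-- An interpretation in `X` of additional symbols of arities `arI`. -/
abbrev Interp (X : Str.{u, v, w} S) (arI : I → List S.Ty) : Type w :=
  (Q : I) → Set (X.Tuple (arI Q))

/-- The expansion of `X` by an interpretation of additional symbols. This is `Program.expand`
without reference to a program. -/
def Str.extend (X : Str.{u, v, w} S) (J : Interp X arI) : Str.{u, v, w} (S.extend I arI) where
  dom := X.dom
  rel
    | .inl R => X.rel R
    | .inr Q => J Q

/-- The rule `r`, read as an implication with all its variables universally quantified, is valid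
in the expansion of `A` by `J`. -/
def Rule.Holds (r : Rule S I arI) (A : Str.{u, v, w} S) (J : Interp A arI) : Prop :=
  ∀ h : (t : S.Ty) → Fin (r.nvar t) → A.dom t,
    (∀ a ∈ r.body, a.Holds (A.extend J) h) → (fun i => h _ (r.headArgs i)) ∈ J r.head

variable {X A : Str.{u, v, w} S} {JX : Interp X arI} {JA : Interp A arI} {K L : Finset X.Elem}

/-- `f` is a partial homomorphism between the expansions of `X` by `JX` and of `A` by `JA`. -/
structure PMap.IsExpansionHom (JX : Interp X arI) (JA : Interp A arI) (f : PMap X A K) :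
    Prop where
  isPartialHom : f.IsPartialHom
  preserves (Q : I) : f.Preserves (JX Q) (JA Q)

theorem PMap.IsExpansionHom.restrict {f : PMap X A K} (hf : f.IsExpansionHom JX JA) (h : L ⊆ K) :
    (f.restrict h).IsExpansionHom JX JA where
  isPartialHom R a ha haR := hf.isPartialHom R a (fun i => h (ha i)) haR
  preserves Q y hy hyQ := hf.preserves Q y (fun i => h (hy i)) hyQ

theorem PMap.IsExpansionHom.map_holds {f : PMap X A K} (hf : f.IsExpansionHom JX JA)
    {V : S.Ty → Type} {h : (t : S.Ty) → V t → X.dom t}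
    (hK : ∀ t x, (⟨t, h t x⟩ : X.Elem) ∈ K) {a : Atom (S.extend I arI) V}
    (ha : a.Holds (X.extend JX) h) :
    a.Holds (A.extend JA) fun t x => f ⟨⟨t, h t x⟩, hK t x⟩ := by
  match a, ha with
  | .rel (.inl R) z, hz => exact hf.isPartialHom R _ (fun i => hK _ (z i)) hz
  | .rel (.inr Q) z, hz => exact hf.preserves Q _ (fun i => hK _ (z i)) hz
  | .eq t x y, hxy =>
    have hsubst {b c : X.dom t} (hb : (⟨t, b⟩ : X.Elem) ∈ K) (hc : (⟨t, c⟩ : X.Elem) ∈ K)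
        (hbc : b = c) : f ⟨⟨t, b⟩, hb⟩ = f ⟨⟨t, c⟩, hc⟩ := by
      subst hbc
      rfl
    exact hsubst (hK t x) (hK t y) hxy

end Expansions

namespace Program

open Filter

variable {S : Signature.{u, v}} {φ : Program S} {A X : Str.{u, v, w} S} {k : ℕ}

/-- The least fixed point of the evaluation of `φ` on `X`, restricted to the additional symbols. -/
def derived (φ : Program S) (X : Str.{u, v, w} S) : Interp X φ.arI :=
  fun Q => {y | ∃ n, y ∈ φ.stage X n Q}

/-- All rules of `φ` are valid in the expansion of `A` by `J`. -/
def IsModel (φ : Program S) (A : Str.{u, v, w} S) (J : Interp A φ.arI) : Prop :=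
  ∀ r ∈ φ.rules, r.Holds A J

theorem holds_expand_iff {J : Interp X φ.arI} {V : S.Ty → Type} {h : (t : S.Ty) → V t → X.dom t}
    {a : Atom (S.extend φ.I φ.arI) V} : a.Holds (φ.expand X J) h ↔ a.Holds (X.extend J) h :=
  match a with
  | .rel (.inl _) _ => Iff.rfl
  | .rel (.inr _) _ => Iff.rfl
  | .eq _ _ _ => Iff.rfl

theorem stage_mono (φ : Program S) (X : Str.{u, v, w} S) (Q : φ.I) :
    Monotone fun n => φ.stage X n Q :=
  monotone_nat_of_le_succ fun _ => Set.subset_union_left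

theorem eventually_holds_stage {V : S.Ty → Type} {h : (t : S.Ty) → V t → X.dom t}
    {a : Atom (S.extend φ.I φ.arI) V} (ha : a.Holds (X.extend (φ.derived X)) h) :
    ∀ᶠ n in atTop, a.Holds (φ.expand X (φ.stage X n)) h := by
  match a, ha with
  | .rel (.inl _) _, ha => exact .of_forall fun _ => ha
  | .rel (.inr Q) _, ⟨n, hn⟩ =>
    filter_upwards [eventually_ge_atTop n] with m hnm using φ.stage_mono X Q hnm hn
  | .eq _ _ _, ha => exact .of_forall fun _ => ha

theorem isModel_derived (φ : Program S) (X : Str.{u, v, w} S) : φ.IsModel X (φ.derived X) := by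
  intro r hr h hbody
  have hstage : ∀ᶠ n in atTop, ∀ a ∈ r.body, a.Holds (φ.expand X (φ.stage X n)) h :=
    (eventually_all_finite r.body.finite_toSet).2 fun a ha =>
      eventually_holds_stage (φ := φ) (hbody a ha)
  obtain ⟨n, hn⟩ := hstage.exists
  exact ⟨n + 1, Or.inr ⟨r, hr, h, hn, rfl⟩⟩

end Program

theorem Rule.exists_card_le_of_numVars_le {S : Signature.{u, v}} {I : Type}
    {arI : I → List S.Ty} {r : Rule S I arI} {X : Str.{u, v, w} S} {k : ℕ}
    (hr : r.numVars ≤ k) (h : (t : S.Ty) → Fin (r.nvar t) → X.dom t) :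
    ∃ M : Finset X.Elem, M.card ≤ k ∧ ∀ t i, (⟨t, h t i⟩ : X.Elem) ∈ M := by
  classical
  have : Finite (Σ t, Fin (r.nvar t)) :=
    ENat.card_lt_top.1 (hr.trans_lt (ENat.natCast_lt_top k))
  have := Fintype.ofFinite (Σ t, Fin (r.nvar t))
  rw [Rule.numVars, ENat.card_eq_coe_fintype_card, Nat.cast_le] at hr
  exact ⟨Finset.univ.image fun x : Σ t, Fin (r.nvar t) => ⟨x.1, h x.1 x.2⟩,
    Finset.card_image_le.trans hr,
    fun t i => Finset.mem_image_of_mem _ (Finset.mem_univ (⟨t, i⟩ : Σ t, Fin (r.nvar t)))⟩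

theorem IsConsistentFamily.preserves_stage {P : Signature.{u, v}} {φ : Program P} {k : ℕ}
    {A X : Str.{u, v, w} P} {G : (K : Finset X.Elem) → Set (PMap X A K)}
    (hG : IsConsistentFamily k G) (hφ : φ.WidthAtMost k) {J : Interp A φ.arI} (hJ : φ.IsModel A J)
    (n : ℕ) (Q : φ.I) {K : Finset X.Elem} {f : PMap X A K} (hf : f ∈ G K) :
    f.Preserves (φ.stage X n Q) (J Q) := by
  induction n generalizing Q K with
  | zero => exact fun _ _ hy => hy.elim
  | succ n ih =>
    rintro y hyK (hy | ⟨r, hr, h, hbody, ⟨⟩⟩)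
    · exact ih Q hf y hyK hy
    obtain ⟨M, hMk, hM⟩ := Rule.exists_card_le_of_numVars_le (hφ r hr) h
    obtain ⟨g, hg, hgf⟩ := hG.exists_mem_eqOn_inter hf hMk
    have hgJ : g.IsExpansionHom (φ.stage X n) J := ⟨hG.isPartialHom hg, fun Q => ih Q hg⟩
    have hhead := hJ r hr _ fun a ha =>
      hgJ.map_holds hM (Program.holds_expand_iff.1 (hbody a ha))
    have hgy : (fun i => g ⟨⟨_, h _ (r.headArgs i)⟩, hM _ _⟩) = f.mapTuple _ hyK :=
      funext fun i => hgf _ (hyK i) (hM _ _)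
    rwa [hgy] at hhead

theorem Program.output_nonempty_of_testAccepts {P : Signature.{u, v}} {φ : Program P} {k : ℕ}
    {A X : Str.{u, v, w} P} (hs : φ.IsSentence) (hφ : φ.WidthAtMost k) (hA : A.IsFinite)
    {J : Interp A φ.arI} (hJ : φ.IsModel A J) (hacc : TestAccepts k A X)
    (hX : φ.IsTrue X) : ((φ.expand A J).rel φ.output).Nonempty := by
  obtain ⟨f, hf⟩ := hacc ∅ k.zero_le
  have hcons := isConsistentFamily_consistent (k := k) (X := X) hA
  have hnullary : IsEmpty (Fin ((P.extend φ.I φ.arI).ar φ.output).length) := by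
    rw [show (P.extend φ.I φ.arI).ar φ.output = [] from hs]
    exact Fin.isEmpty
  unfold Program.IsTrue at hX
  generalize φ.output = o at *
  obtain ⟨y, hy⟩ := hX
  match o, hnullary, y, hy with
  | .inl R, hnullary, y, hy => exact ⟨_, hcons.isPartialHom hf R y (fun i => hnullary.elim i) hy⟩
  | .inr Q, hnullary, y, ⟨n, hn⟩ =>
    exact ⟨_, hcons.preserves_stage hφ hJ n Q hf y (fun i => hnullary.elim i) hn⟩

theorem DatalogExpressible.hasWidth {P : Signature.{u, v}} {k : ℕ} {A A' : Str.{u, v, w} P}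
    (hA : A.IsFinite) (h : DatalogExpressible k A A') : HasWidth k A A' := by
  obtain ⟨φ, hs, hφ, hpos, hneg⟩ := h
  refine ⟨fun X _ hXA => hXA.testAccepts, fun X hX hXA' hacc => ?_⟩
  have hXtrue : φ.IsTrue X := not_not.1 (hneg X hX hXA')
  have hAfalse : ¬ φ.IsTrue A := hpos A hA ⟨fun _ a => a, fun _ _ ha => ha⟩
  exact hAfalse (Program.output_nonempty_of_testAccepts hs hφ hA (φ.isModel_derived A) hacc hXtrue)

section Finiteness

variable {S : Signature.{u, v}}

theorem Atom.finite (hS : S.IsFinite) {V : S.Ty → Type} [∀ t, Finite (V t)] :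
    Finite (Atom S V) := by
  have := hS.1
  have := hS.2
  let toAtom : ((Σ R : S.Sym, (i : Fin (S.ar R).length) → V ((S.ar R).get i)) ⊕
      (Σ t : S.Ty, V t × V t)) → Atom S V :=
    Sum.elim (fun x => .rel x.1 x.2) fun x => .eq x.1 x.2.1 x.2.2
  refine Finite.of_surjective toAtom ?_
  rintro (⟨R, x⟩ | ⟨t, x, y⟩)
  · exact ⟨.inl ⟨R, x⟩, rfl⟩
  · exact ⟨.inr ⟨t, x, y⟩, rfl⟩

variable {I : Type} {arI : I → List S.Ty}

theorem Rule.nvar_le_of_numVars_le {r : Rule S I arI} {k : ℕ}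
    (hr : r.numVars ≤ k) (t : S.Ty) : r.nvar t ≤ k := by
  have h : ENat.card (Fin (r.nvar t)) ≤ r.numVars :=
    ENat.card_le_card_of_injective (sigma_mk_injective (β := fun t => Fin (r.nvar t)) (i := t))
  rw [ENat.card_eq_coe_fintype_card, Fintype.card_fin] at h
  exact Nat.cast_le.1 (h.trans hr)

variable [Finite I]

theorem Signature.IsFinite.extend (hS : S.IsFinite) (arI : I → List S.Ty) :
    (S.extend I arI).IsFinite :=
  have := hS.2
  ⟨hS.1, inferInstanceAs (Finite (S.Sym ⊕ I))⟩

theorem Atom.finite_extend (hS : S.IsFinite) (arI : I → List S.Ty) (nvar : S.Ty → ℕ) :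
    Finite (Atom (S.extend I arI) fun t => Fin (nvar t)) :=
  have (t : (S.extend I arI).Ty) : Finite (Fin (nvar t)) := inferInstance
  Atom.finite (hS.extend arI)

theorem Rule.finite_setOf_nvar_eq (hS : S.IsFinite) (arI : I → List S.Ty) (nvar : S.Ty → ℕ) :
    {r : Rule S I arI | r.nvar = nvar ∧ r.body.Nodup}.Finite := by
  classical
  have := Atom.finite_extend hS arI nvar
  have := Fintype.ofFinite (Atom (S.extend I arI) fun t => Fin (nvar t))
  let Data := Σ Q : I, ((i : Fin (arI Q).length) → Fin (nvar ((arI Q).get i))) ×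
    {l : List (Atom (S.extend I arI) fun t => Fin (nvar t)) // l.Nodup}
  let AllOccur (d : Data) : Prop := ∀ x : (Σ t : S.Ty, Fin (nvar t)),
    (∃ i, (⟨(arI d.1).get i, d.2.1 i⟩ : Σ t : S.Ty, Fin (nvar t)) = x) ∨
      ∃ a ∈ d.2.2.1, Atom.Occurs (S := S.extend I arI) x a
  let toRule (d : {d : Data // AllOccur d}) : Rule S I arI :=
    ⟨nvar, d.1.1, d.1.2.1, d.1.2.2.1, d.2⟩
  refine (Set.finite_range toRule).subset ?_
  rintro ⟨_, Q, args, body, occurs⟩ ⟨rfl, hbody⟩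
  exact ⟨⟨⟨Q, args, body, hbody⟩, occurs⟩, rfl⟩

theorem Rule.finite_setOf_numVars_le (hS : S.IsFinite) (arI : I → List S.Ty) (k : ℕ) :
    {r : Rule S I arI | r.numVars ≤ k ∧ r.body.Nodup}.Finite := by
  have := hS.1
  have hnvar : {nvar : S.Ty → ℕ | ∀ t, nvar t ∈ Set.Iic k}.Finite :=
    Set.Finite.pi' fun _ => Set.finite_Iic k
  refine (hnvar.biUnion fun nvar _ => Rule.finite_setOf_nvar_eq hS arI nvar).subset ?_
  exact fun r hr => Set.mem_biUnion (Rule.nvar_le_of_numVars_le hr.1) ⟨rfl, hr.2⟩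

end Finiteness

section Diagram

variable {S : Signature.{u, v}} {X A : Str.{u, v, w} S}

/-- The elements of type `t` in `K`. -/
abbrev Fiber (K : Finset X.Elem) (t : S.Ty) : Type w :=
  {a : X.dom t // (⟨t, a⟩ : X.Elem) ∈ K}

instance (K : Finset X.Elem) (t : S.Ty) : Finite (Fiber K t) :=
  Finite.of_injective (β := K) (fun a => ⟨⟨t, a.1⟩, a.2⟩) fun _ _ hab =>
    Subtype.ext (sigma_mk_injective (Subtype.mk.inj hab))

/-- The numbering of the elements of `K` by variables of their types. -/
noncomputable def varEquiv (K : Finset X.Elem) (t : S.Ty) :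
    Fiber K t ≃ Fin (Nat.card (Fiber K t)) :=
  Finite.equivFin _

/-- The substitution which replaces every variable by the element of `K` that it numbers. -/
noncomputable def varValue (K : Finset X.Elem) (t : S.Ty) (i : Fin (Nat.card (Fiber K t))) :
    X.dom t :=
  ((varEquiv K t).symm i).1

@[simp]
theorem varValue_varEquiv (K : Finset X.Elem) (t : S.Ty) (a : Fiber K t) :
    varValue K t (varEquiv K t a) = a.1 := by
  simp only [varValue, Equiv.symm_apply_apply]

variable {I : Type} {arI : I → List S.Ty} {JX : Interp X arI} {JA : Interp A arI}
  {K : Finset X.Elem}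

theorem isExpansionHom_of_diagram_holds {g : (t : S.Ty) → Fin (Nat.card (Fiber K t)) → A.dom t}
    (hg : ∀ a : Atom (S.extend I arI) fun t => Fin (Nat.card (Fiber K t)),
      a.Holds (X.extend JX) (varValue K) → a.Holds (A.extend JA) g) :
    PMap.IsExpansionHom JX JA fun x : {x // x ∈ K} => g x.1.1 (varEquiv K _ ⟨x.1.2, x.2⟩) where
  isPartialHom R z hz hzR := by
    refine hg (.rel (.inl R) fun i => varEquiv K _ ⟨z i, hz i⟩) ?_
    change (fun i => varValue K _ (varEquiv K _ ⟨z i, hz i⟩)) ∈ X.rel R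
    simpa only [varValue_varEquiv] using hzR
  preserves Q z hz hzQ := by
    refine hg (.rel (.inr Q) fun i => varEquiv K _ ⟨z i, hz i⟩) ?_
    change (fun i => varValue K _ (varEquiv K _ ⟨z i, hz i⟩)) ∈ JX Q
    simpa only [varValue_varEquiv] using hzQ

variable [Finite I]

/-- The rule with a variable for each element of `K` which derives that `y` belongs to `Q`, and
whose body is the diagram of `K` in the expansion of `X` by `J`: all atomic formulae that are true
there. The trivial equalities in the diagram ensure that each variable occurs. -/
noncomputable def diagramRule (hS : S.IsFinite) (J : Interp X arI) (K : Finset X.Elem) (Q : I)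
    (y : X.Tuple (arI Q)) (hy : ∀ i, X.entry y i ∈ K) : Rule S I arI :=
  have := Atom.finite_extend hS arI fun t => Nat.card (Fiber K t)
  have hdiagram := Set.toFinite {a : Atom (S.extend I arI) fun t => Fin (Nat.card (Fiber K t)) |
    a.Holds (X.extend J) (varValue K)}
  { nvar := fun t => Nat.card (Fiber K t)
    head := Q
    headArgs := fun i => varEquiv K _ ⟨y i, hy i⟩
    body := hdiagram.toFinset.toList
    occurs := fun x => Or.inr ⟨.eq x.1 x.2 x.2,
      Finset.mem_toList.2 (hdiagram.mem_toFinset.2 rfl), Or.inl rfl⟩ }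

variable {hS : S.IsFinite} {Q : I} {y : X.Tuple (arI Q)}
  {hy : ∀ i, X.entry y i ∈ K}

theorem mem_body_diagramRule {a : Atom (S.extend I arI) fun t => Fin (Nat.card (Fiber K t))} :
    a ∈ (diagramRule hS JX K Q y hy).body ↔ a.Holds (X.extend JX) (varValue K) :=
  Finset.mem_toList.trans (Set.Finite.mem_toFinset _)

theorem nodup_body_diagramRule : (diagramRule hS JX K Q y hy).body.Nodup :=
  Finset.nodup_toList _

theorem numVars_diagramRule : (diagramRule hS JX K Q y hy).numVars = K.card := by
  let fiberSigmaEquiv : (Σ t, Fiber K t) ≃ K :=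
    { toFun := fun x => ⟨⟨x.1, x.2.1⟩, x.2.2⟩
      invFun := fun x => ⟨x.1.1, x.1.2, x.2⟩ }
  calc ENat.card (Σ t, Fin (Nat.card (Fiber K t)))
    _ = ENat.card K :=
      ENat.card_congr ((Equiv.sigmaCongrRight fun t => (varEquiv K t).symm).trans fiberSigmaEquiv)
    _ = K.card := by rw [ENat.card_eq_coe_fintype_card, Fintype.card_coe]

theorem diagramRule_holds
    (h : ∀ g : PMap X A K, g.IsExpansionHom JX JA → g.mapTuple y hy ∈ JA Q) :
    (diagramRule hS JX K Q y hy).Holds A JA :=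
  fun _ hbody => h _ (isExpansionHom_of_diagram_holds fun a ha =>
    hbody a (mem_body_diagramRule.2 ha))

end Diagram

section CanonicalProgram

variable {P : Signature.{u, v}} {A X : Str.{u, v, w} P} {I : Type}
  {arI : I → List P.Ty} {J : Interp A arI} {k : ℕ}

/-- Every relation of arity at most `k` on `A` is the interpretation of some symbol. The equality
is one of pairs, since the two relations have different types before the arities are identified. -/
def Interp.NamesRelations (J : Interp A arI) (k : ℕ) : Prop :=
  ∀ (τ : List P.Ty) (σ : Set (A.Tuple τ)), τ.length ≤ k →
    ∃ Q, (⟨arI Q, J Q⟩ : Σ τ : List P.Ty, Set (A.Tuple τ)) = ⟨τ, σ⟩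

theorem exists_namesRelations (hP : P.IsFinite) (hA : A.IsFinite) (k : ℕ) :
    ∃ (n : ℕ) (arI : Fin n → List P.Ty) (J : Interp A arI), J.NamesRelations k := by
  have := hP.1
  have : ∀ t, Finite (A.dom t) := hA
  have : Finite {τ : List P.Ty // τ.length ≤ k} := (List.finite_length_le P.Ty k).to_subtype
  have : Finite {p : Σ τ : List P.Ty, Set (A.Tuple τ) // p.1.length ≤ k} :=
    .of_equiv _ (Equiv.subtypeSigmaEquiv (fun τ : List P.Ty => Set (A.Tuple τ))
      fun τ => τ.length ≤ k).symm
  obtain ⟨n, ⟨e⟩⟩ :=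
    Finite.exists_equiv_fin {p : Σ τ : List P.Ty, Set (A.Tuple τ) // p.1.length ≤ k}
  refine ⟨n, fun Q => (e.symm Q).1.1, fun Q => (e.symm Q).1.2, fun τ σ hτ => ?_⟩
  obtain ⟨Q, hQ⟩ := e.symm.surjective ⟨⟨τ, σ⟩, hτ⟩
  exact ⟨Q, congrArg Subtype.val hQ⟩

/-- The program with output `o` that consists of all rules with at most `k` variables that are valid
in the expansion of `A` by `J`. Repetitions in the bodies, which are lists, are excluded so that
there are finitely many rules. If `J` names all relations of arity at most `k` and `o` names the
empty nullary one, then this is the canonical Datalog program of width `k` of `A`. -/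
def canonicalProgram [Finite I] (hP : P.IsFinite) (J : Interp A arI) (k : ℕ) (o : I) :
    Program P where
  I := I
  finite_I := inferInstance
  arI := arI
  rules := {r | (r.numVars ≤ k ∧ r.body.Nodup) ∧ r.Holds A J}
  finite_rules := (Rule.finite_setOf_numVars_le hP arI k).subset fun _ hr => hr.1
  output := .inr o

variable [Finite I] {o : I} {hP : P.IsFinite}

theorem isModel_canonicalProgram : (canonicalProgram hP J k o).IsModel A J :=
  fun _ hr => hr.2

theorem widthAtMost_canonicalProgram : (canonicalProgram hP J k o).WidthAtMost k :=
  fun _ hr => hr.1.1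

theorem mem_derived_canonicalProgram {K : Finset X.Elem} (hK : K.card ≤ k) {Q : I}
    {y : X.Tuple (arI Q)} (hy : ∀ i, X.entry y i ∈ K)
    (h : ∀ g : PMap X A K, g.IsExpansionHom ((canonicalProgram hP J k o).derived X) J →
      g.mapTuple y hy ∈ J Q) :
    y ∈ (canonicalProgram hP J k o).derived X Q := by
  let D : Interp X arI := (canonicalProgram hP J k o).derived X
  have hvalid : (diagramRule hP D K Q y hy).Holds A J := diagramRule_holds h
  have hmem : diagramRule hP D K Q y hy ∈ (canonicalProgram hP J k o).rules :=
    ⟨⟨numVars_diagramRule.trans_le (Nat.cast_le.2 hK), nodup_body_diagramRule⟩, hvalid⟩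
  have hhead := (canonicalProgram hP J k o).isModel_derived X _ hmem (varValue K)
    fun _ => (mem_body_diagramRule (JX := D)).1
  have hy' : (fun i => varValue K _ ((diagramRule hP D K Q y hy).headArgs i)) = y :=
    funext fun i => varValue_varEquiv K _ _
  exact Set.mem_of_eq_of_mem hy'.symm hhead

theorem mapTuple_mem_of_isExpansionHom (hJ : J.NamesRelations k) {K L : Finset X.Elem}
    (hLK : L ⊆ K) (hK : K.card ≤ k) {f : PMap X A L}
    (hf : f.IsExpansionHom ((canonicalProgram hP J k o).derived X) J) {τ : List P.Ty}
    (hτ : τ.length ≤ k) {σ : Set (A.Tuple τ)} (y : X.Tuple τ) (hy : ∀ i, X.entry y i ∈ L)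
    (h : ∀ g : PMap X A K, g.IsExpansionHom ((canonicalProgram hP J k o).derived X) J →
      g.mapTuple y (fun i => hLK (hy i)) ∈ σ) :
    f.mapTuple y hy ∈ σ := by
  obtain ⟨Q, ⟨⟩⟩ := hJ τ σ hτ
  exact hf.preserves Q y hy (mem_derived_canonicalProgram hK _ h)

theorem isConsistentFamily_isExpansionHom (hJ : J.NamesRelations k) :
    IsConsistentFamily k fun K : Finset X.Elem =>
      {f : PMap X A K | f.IsExpansionHom ((canonicalProgram hP J k o).derived X) J} where
  isPartialHom hf := hf.isPartialHom
  restrict_mem h _ hf := hf.restrict h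
  exists_extension {L K} h hK f hf := by
    obtain ⟨τ, y, hlen, hy⟩ := X.exists_tuple_range_eq L
    have hyL : ∀ i, X.entry y i ∈ L := fun i => Finset.mem_coe.1 (hy ▸ Set.mem_range_self i)
    have hτ : τ.length ≤ k := hlen.trans_le ((Finset.card_le_card h).trans hK)
    obtain ⟨g, hg, hgf⟩ := mapTuple_mem_of_isExpansionHom hJ h hK hf hτ
      (σ := {z | ∃ g : PMap X A K, g.IsExpansionHom ((canonicalProgram hP J k o).derived X) J ∧
        g.mapTuple y (fun i => h (hyL i)) = z}) y hyL fun g hg => ⟨g, hg, rfl⟩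
    refine ⟨g, hg, funext ?_⟩
    rintro ⟨x, hx⟩
    obtain ⟨i, rfl⟩ : x ∈ Set.range (X.entry y) := hy ▸ hx
    exact congrFun hgf i

theorem isTrue_canonicalProgram_iff (hA : A.IsFinite) (hJ : J.NamesRelations k)
    (ho : arI o = []) (hJo : ¬ (J o).Nonempty) :
    (canonicalProgram hP J k o).IsTrue X ↔ ¬ TestAccepts k A X := by
  constructor
  · intro hX hacc
    exact hJo (Program.output_nonempty_of_testAccepts (φ := canonicalProgram hP J k o) ho
      widthAtMost_canonicalProgram hA isModel_canonicalProgram hacc hX)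
  · intro hrej
    have hnullary : IsEmpty (Fin (arI o).length) := by
      rw [ho]
      exact Fin.isEmpty
    have hempty : ∀ g : PMap X A ∅,
        ¬ g.IsExpansionHom ((canonicalProgram hP J k o).derived X) J :=
      fun g hg => hrej ((isConsistentFamily_isExpansionHom hJ).testAccepts ⟨g, hg⟩)
    exact ⟨fun i => hnullary.elim i, mem_derived_canonicalProgram (K := ∅) k.zero_le
      (fun i => hnullary.elim i) fun g hg => (hempty g hg).elim⟩

theorem exists_sentence_isTrue_iff_not_testAccepts (hP : P.IsFinite) (hA : A.IsFinite) (k : ℕ) :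
    ∃ φ : Program P, φ.IsSentence ∧ φ.WidthAtMost k ∧
      ∀ X : Str.{u, v, w} P, φ.IsTrue X ↔ ¬ TestAccepts k A X := by
  obtain ⟨n, arI, J, hJ⟩ := exists_namesRelations hP hA k
  obtain ⟨o, ho⟩ := hJ [] ∅ k.zero_le
  have harI : arI o = [] := congrArg Sigma.fst ho
  have hJo : (J o).Nonempty = (∅ : Set (A.Tuple [])).Nonempty :=
    congrArg (fun p : Σ τ : List P.Ty, Set (A.Tuple τ) => p.2.Nonempty) ho
  exact ⟨canonicalProgram hP J k o, harI, widthAtMost_canonicalProgram, fun X =>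
    isTrue_canonicalProgram_iff hA hJ harI (hJo ▸ Set.not_nonempty_empty)⟩

theorem HasWidth.datalogExpressible {A' : Str.{u, v, w} P} (hP : P.IsFinite) (hA : A.IsFinite)
    (h : HasWidth k A A') : DatalogExpressible k A A' := by
  obtain ⟨φ, hs, hφ, hiff⟩ := exists_sentence_isTrue_iff_not_testAccepts hP hA k
  refine ⟨φ, hs, hφ, ?_⟩
  simpa only [hiff, not_not, HasWidth] using h

end CanonicalProgram

end PCSP

/-- A promise CSP (with finite signature and template `(A, A')`, `A` finite, `A` mapping to `A'`)
has width `k`, i.e. is solved by the `k`-consistency test, if and only if it reduces to the trivial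
CSP by the `k`-consistency reduction; and this is also equivalent to expressibility by a Datalog
sentence of width at most `k`. -/
theorem theorem4p1 {P : PCSP.Signature} (hP : P.IsFinite) (A A' : PCSP.Str P)
    (hA : A.IsFinite) (hAA' : A.MapsTo A') (k : ℕ) (hk : 1 ≤ k) :
    (PCSP.HasWidth k A A' ↔ PCSP.ReducesByConsistency k A A' PCSP.botStr PCSP.botStr) ∧
    (PCSP.HasWidth k A A' ↔ PCSP.DatalogExpressible k A A') := by
  exact ⟨PCSP.reducesByConsistency_botStr_iff.symm,
    fun h => h.datalogExpressible hP hA, fun h => h.hasWidth hA⟩
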